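/- Let $G=(V,E)$ be a finite acyclic directed multigraph (nodes $V$, channels $E$, parallel channels allowed) with source node $s\in V$ and a set $T=\{t_1,\dots,t_l\}\subseteq V\setminus\{s\}$ of $l\ge 1$ distinct sink nodes. Let $\mathcal F$ be a finite field and let the information rate $w$ satisfy $w\le C_{t_i}$ for every $i$, where $C_{t}$ is the minimum cut capacity between $s$ and $t$. Add $w$ imaginary channels $d_1,\dots,d_w$ entering $s$, whose global encoding kernels are the standard basis vectors of $\mathcal F^w$. In random linear network coding the local encoding coefficients $k_{d,e}$, one for each adjacent pair of channels ($\mathrm{head}(d)=\mathrm{tail}(e)$, $d$ possibly imaginary), are independent and uniformly distributed on $\mathcal F$; the global encoding kernels $f_e\in\mathcal F^w$, $e\in E$, are determined by $f_e=\sum_{d\in In(\mathrm{tail}(e))}k_{d,e}f_d$; and the failure probability is $P_e=\Pr(\exists\, t\in T:\ \mathrm{rank}(F_t)<w)$, where $F_t=(f_e:\ e\in E,\ \mathrm{head}(e)=t)$. Let $R_i$ be the minimum number of internal nodes (distinct nodes on the paths other than $s$ and $t_i$) over all collections of $w$ channel-disjoint paths from $s$ to $t_i$, and write $\sum_{i=1}^{l}R_i=lb'+u'$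 with integers $b'\ge 0$ and $0\le u'\le l-1$. Put $a=1-\prod_{h=1}^{w}\bigl(1-|\mathcal F|^{-h}\bigr)$. Then, whenever $la\le 1$, $$P_e\le 1-(1-a)^{l}(1-la)^{b'}(1-u'a).$$ Moreover, without the condition $la\le 1$, one always has $$P_e\le 1-(1-a)^{l}\,\bigl(\max\{0,1-la\}\bigr)^{b'}\max\{0,1-u'a\}$$ (with $0^0=1$), whose right-hand side equals that of the first bound when $la\le 1$. -/

import Mathlib

/-- A finite acyclic directed multigraph: `V` is the set of nodes, `E` the set of channels, and
a channel `e` leads from the node `tail e` to the node `head e`.  Parallel channels are allowed;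
there is no directed cycle. (Finiteness is imposed by instances on `V` and `E`.) -/
structure Network (V E : Type*) where
  tail : E → V
  head : E → V
  acyclic : ∀ v : V, ¬ Relation.TransGen (fun x y => ∃ e : E, tail e = x ∧ head e = y) v v

namespace Network

/-! ### Cuts and paths -/

section Topology

variable {V E : Type*} (N : Network V E)

/-- The minimum cut capacity between `s` and `t`: the least number of channels leaving a set of
nodes that contains `s` but not `t`. -/
noncomputable def minCut (s t : V) : ℕ :=
  sInf {c : ℕ | ∃ A : Set V, s ∈ A ∧ t ∉ A ∧ {e : E | N.tail e ∈ A ∧ N.head e ∉ A}.ncard = c}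

/-- `p = [e₁, …, eₘ]` (with `m ≥ 1`) is a path from `s` to `t`: `tail e₁ = s`, `head eₘ = t` and
`head eₖ = tail eₖ₊₁`. -/
def IsPath (s t : V) (p : List E) : Prop :=
  ∃ h : p ≠ [], N.tail (p.head h) = s ∧ N.head (p.getLast h) = t ∧
    p.IsChain (fun d e => N.head d = N.tail e)

/-- `P` is a collection of `w` channel-disjoint paths from `s` to `t`. -/
def IsDisjointPaths (s t : V) {w : ℕ} (P : Fin w → List E) : Prop :=
  (∀ j, N.IsPath s t (P j)) ∧ ∀ i j, i ≠ j → (P i).Disjoint (P j)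

/-- The internal nodes of a collection of paths from `s` to `t`: all nodes on these paths other
than `s` and `t`. -/
def internalNodes (s t : V) {w : ℕ} (P : Fin w → List E) : Set V :=
  {v | v ≠ s ∧ v ≠ t ∧ ∃ j, ∃ e ∈ P j, N.tail e = v ∨ N.head e = v}

/-- The minimum number of internal nodes over all collections of `w` channel-disjoint paths from
`s` to `t`. -/
noncomputable def minInternal (s : V) (w : ℕ) (t : V) : ℕ :=
  sInf {r : ℕ | ∃ P : Fin w → List E, N.IsDisjointPaths s t P ∧ (N.internalNodes s t P).ncard = r}

end Topology

/-! ### Random linear network coding -/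

section Coding

variable {V E : Type*} (N : Network V E)

/-- The head of a channel, where `w` imaginary channels `Sum.inl j`, all with head `s`, have been
added to the real channels `Sum.inr e`. -/
def extHead (s : V) (w : ℕ) : Fin w ⊕ E → V := Sum.elim (fun _ => s) N.head

/-- A choice of local encoding coefficients `k (d, e)`, one for every adjacent pair of channels,
i.e. a (possibly imaginary) channel `d` and a channel `e` with `head d = tail e`. -/
abbrev LocalCoeffs (s : V) (w : ℕ) (F : Type*) : Type _ :=
  {p : (Fin w ⊕ E) × E // N.extHead s w p.1 = N.tail p.2} → F

theorem wellFounded_adj [Finite E] : WellFounded (fun d e : E => N.head d = N.tail e) := by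
  have key : ∀ d e : E, Relation.TransGen (fun d e : E => N.head d = N.tail e) d e →
      Relation.TransGen (fun x y => ∃ e : E, N.tail e = x ∧ N.head e = y) (N.tail d) (N.tail e) := by
    intro d e h
    induction h with
    | single h => exact .single ⟨d, rfl, h⟩
    | tail _ h ih => exact ih.tail ⟨_, rfl, h⟩
  have : Std.Irrefl (Relation.TransGen (fun d e : E => N.head d = N.tail e)) :=
    ⟨fun e h => N.acyclic _ (key e e h)⟩
  have wf := Finite.wellFounded_of_trans_of_irrefl
    (Relation.TransGen (fun d e : E => N.head d = N.tail e))
  exact wf.mono fun _ _ h => .single h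

variable [Fintype E] {F : Type*} [Field F] {s : V} {w : ℕ}

open Classical in
/-- The global encoding kernel `f_e ∈ F^w` of a channel `e`, determined recursively by
`f_e = ∑_{d ∈ In(tail e)} k (d, e) • f_d`, where the `j`-th imaginary channel carries the
`j`-th source symbol, i.e. its kernel is the `j`-th standard basis vector. -/
noncomputable def kernel (k : N.LocalCoeffs s w F) : E → Fin w → F :=
  N.wellFounded_adj.fix fun e ih =>
    ∑ d : {d : Fin w ⊕ E // N.extHead s w d = N.tail e},
      k ⟨(d.1, e), d.2⟩ •
        (match d with
          | ⟨.inl j, _⟩ => Pi.single j 1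
          | ⟨.inr d', h⟩ => ih d' h)

open Classical in
/-- The defining recursion of the global encoding kernels. -/
theorem kernel_eq (k : N.LocalCoeffs s w F) (e : E) :
    N.kernel k e = ∑ d : {d : Fin w ⊕ E // N.extHead s w d = N.tail e},
      k ⟨(d.1, e), d.2⟩ • Sum.elim (fun j => Pi.single j 1) (N.kernel k) d.1 := by
  rw [kernel, WellFounded.fix_eq]
  refine Finset.sum_congr rfl fun d _ => ?_
  rcases d with ⟨j | d', h⟩ <;> rfl

/-- The decoding matrix `F_t` of size `w × |In(t)|`, whose columns are the global encoding kernels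
of the incoming channels of `t`. -/
noncomputable def decodingMatrix (k : N.LocalCoeffs s w F) (t : V) :
    Matrix (Fin w) {e : E // N.head e = t} F :=
  Matrix.of fun i e => N.kernel k e.1 i

variable (F s w)

open Classical in
/-- The failure probability of random linear network coding: the probability that
`rank F_t < w` for some sink `t ∈ T`, when the local encoding coefficients are independent and
uniform on `F`, i.e. when their joint distribution is uniform on the finite set of all choices. -/
noncomputable def failureProb [Fintype F] (T : Finset V) : ℝ :=
  (Nat.card {k : N.LocalCoeffs s w F // ∃ t ∈ T, (N.decodingMatrix k t).rank < w} : ℝ) /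
    (Nat.card (N.LocalCoeffs s w F) : ℝ)

end Coding

end Network

/-- `a = 1 - ∏_{h=1}^{w} (1 - 1 / |F| ^ h)`. -/
noncomputable def codingConst (F : Type*) [Fintype F] (w : ℕ) : ℝ :=
  1 - ∏ h ∈ Finset.Icc 1 w, (1 - 1 / (Fintype.card F : ℝ) ^ h)

set_option linter.unusedSectionVars false

namespace Network

/-! ### Max-flow min-cut, and decomposition of a flow into channel-disjoint paths. -/

section Menger

variable {V E : Type*} (N : Network V E)

/-! Menger's theorem (`exists_disjoint_paths`) gives each sink `w` channel-disjoint paths; choose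
them with the fewest internal nodes. Scan the nodes in topological order, through sets `S` closed
under predecessors. For each sink keep the `w` channels on which its paths last leave `S`, starting
from the imaginary ones. If their kernels are independent when `S` is everything, the sink decodes.

Adding a node `v` exchanges, for each sink, the channels on which its paths enter `v` for those on
which they leave it. With the coefficients at other nodes fixed, the new kernels are images of
independent uniform vectors, one per outgoing channel, and independence survives for one sink with
probability at least `1 - a`. Let `A` be the sinks for which `v` is a chosen last tail node: their
path channels leaving `v` go straight to the sink, so different sinks of `A` use different channels
and the bounds multiply. The other sinks `B` whose paths leave `v` are handled by a union bound
relative to success on `A`. Such conditioning does no harm, since avoiding one subspace never makes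
avoiding another less likely (`cnt_avoid_subspace`). The factor at `v` is therefore `(1 - a) ^ |A| *
max 0 (1 - |B| * a)` (`cnt_cutIndependent_insert`).

Each sink lies in `A` at exactly one node, which yields `(1 - a) ^ l`. It lies in `B` at no more
than `R_i` nodes: its tail nodes are internal or `s`, and the last one has been removed. Since `|B|
≤ l` at every node, the product of the union factors is smallest when the total is packed into
blocks of size `l` (`worstProduct_le_prod`), which gives `b'` full blocks and one of size `u'`. -/

theorem tail_ne_head (e : E) : N.tail e ≠ N.head e := fun h =>
  N.acyclic (N.tail e) (.single ⟨e, rfl, h.symm⟩)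

open Classical in
/-- The net outflow at the node `v` of the `0`-`1` flow carried by the channels in `X`. -/
noncomputable def net (X : Finset E) (v : V) : ℤ :=
  ∑ e ∈ X, ((if N.tail e = v then 1 else 0) - (if N.head e = v then 1 else 0))

open Classical in
theorem net_insert {X : Finset E} {e : E} (he : e ∉ X) (v : V) :
    N.net (insert e X) v = N.net X v +
      ((if N.tail e = v then 1 else 0) - (if N.head e = v then 1 else 0)) := by
  rw [net, Finset.sum_insert he, add_comm]; rfl

open Classical in
theorem net_erase {X : Finset E} {e : E} (he : e ∈ X) (v : V) :
    N.net (X.erase e) v = N.net X v -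
      ((if N.tail e = v then 1 else 0) - (if N.head e = v then 1 else 0)) := by
  have := N.net_insert (Finset.notMem_erase e X) v
  rw [Finset.insert_erase he] at this
  linarith

open Classical in
theorem sum_net (X : Finset E) (A : Finset V) :
    ∑ v ∈ A, N.net X v =
      ∑ e ∈ X, ((if N.tail e ∈ A then 1 else 0) - (if N.head e ∈ A then 1 else 0)) := by
  simp only [net]
  rw [Finset.sum_comm]
  refine Finset.sum_congr rfl fun e _ => ?_
  rw [Finset.sum_sub_distrib, Finset.sum_ite_eq, Finset.sum_ite_eq]

open Classical in
/-- A unit of flow can be sent from `s` to any node of `A` by changing only channels inside `A`. -/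
def Augmentable (X : Finset E) (s : V) (A : Finset V) : Prop :=
  ∀ v ∈ A, ∃ Y : Finset E,
    (∀ u, N.net Y u = N.net X u + (if s = u then 1 else 0) - (if v = u then 1 else 0)) ∧
      ∀ e, (e ∈ Y ↔ e ∈ X) ∨ (N.tail e ∈ A ∧ N.head e ∈ A)

open Classical in
theorem Augmentable.insert_head {X : Finset E} {s : V} {A : Finset V} (h : N.Augmentable X s A)
    {e : E} (he : e ∉ X) (ht : N.tail e ∈ A) (hh : N.head e ∉ A) :
    N.Augmentable X s (insert (N.head e) A) := by
  intro v hv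
  rcases Finset.mem_insert.1 hv with rfl | hv
  · obtain ⟨Y, hY, hYX⟩ := h _ ht
    have heY : e ∉ Y := by
      rcases hYX e with h | h
      · exact fun h' => he (h.1 h')
      · exact absurd h.2 hh
    refine ⟨insert e Y, fun u => ?_, fun d => ?_⟩
    · rw [N.net_insert heY, hY]; ring
    · by_cases hd : d = e
      · subst hd; right; simp [ht]
      · rcases hYX d with h | h
        · left; simp [hd, h]
        · right; simp [h.1, h.2]
  · obtain ⟨Y, hY, hYX⟩ := h _ hv
    refine ⟨Y, hY, fun d => (hYX d).imp_right fun h => ?_⟩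
    simp [h.1, h.2]

open Classical in
theorem Augmentable.insert_tail {X : Finset E} {s : V} {A : Finset V} (h : N.Augmentable X s A)
    {e : E} (he : e ∈ X) (ht : N.tail e ∉ A) (hh : N.head e ∈ A) :
    N.Augmentable X s (insert (N.tail e) A) := by
  intro v hv
  rcases Finset.mem_insert.1 hv with rfl | hv
  · obtain ⟨Y, hY, hYX⟩ := h _ hh
    have heY : e ∈ Y := by
      rcases hYX e with h | h
      · exact h.2 he
      · exact absurd h.1 ht
    refine ⟨Y.erase e, fun u => ?_, fun d => ?_⟩
    · rw [N.net_erase heY, hY]; ring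
    · by_cases hd : d = e
      · subst hd; right; simp [hh]
      · rcases hYX d with h | h
        · left; simp [hd, h]
        · right; simp [h.1, h.2]
  · obtain ⟨Y, hY, hYX⟩ := h _ hv
    refine ⟨Y, hY, fun d => (hYX d).imp_right fun h => ?_⟩
    simp [h.1, h.2]

/-- Max-flow min-cut for `0`-`1` flows. -/
theorem exists_flow [Fintype V] [Fintype E] {s t : V} (hst : s ≠ t) :
    ∃ X : Finset E, (∀ v, v ≠ s → v ≠ t → N.net X v = 0) ∧ (N.minCut s t : ℤ) ≤ N.net X s := by
  classical
  obtain ⟨X, hX, hmax⟩ := Set.exists_max_image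
    {X : Finset E | ∀ v, v ≠ s → v ≠ t → N.net X v = 0} (fun X => N.net X s) (Set.toFinite _)
    ⟨∅, fun v _ _ => by simp [net]⟩
  -- `A` plays the role of the residual reachable set of the maximum flow `X`; its boundary will be
  -- a saturated cut.
  obtain ⟨A, ⟨hsA, hA⟩, hAmax⟩ := Set.exists_max_image
    {A : Finset V | s ∈ A ∧ N.Augmentable X s A} Finset.card (Set.toFinite _)
    ⟨{s}, by simp, fun v hv => ⟨X, fun u => by simp_all, fun e => by simp⟩⟩
  refine ⟨X, hX, ?_⟩
  have htA : t ∉ A := by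
    intro ht
    -- If `t` were in `A`, this `Y` would be a flow of value one more than the maximum.
    obtain ⟨Y, hY, -⟩ := hA t ht
    have h1 := hmax Y fun v hvs hvt => by
      rw [hY, hX v hvs hvt]; simp [hvs.symm, hvt.symm]
    simp only [hY s, if_neg hst.symm] at h1
    simp at h1
  have hout : ∀ e, N.tail e ∈ A → N.head e ∉ A → e ∈ X := by
    intro e ht hh
    by_contra he
    have := hAmax _ ⟨Finset.mem_insert_of_mem hsA, hA.insert_head N he ht hh⟩
    rw [Finset.card_insert_of_notMem hh] at this
    omega
  have hin : ∀ e ∈ X, N.head e ∈ A → N.tail e ∈ A := by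
    intro e he hh
    by_contra ht
    have := hAmax _ ⟨Finset.mem_insert_of_mem hsA, hA.insert_tail N he ht hh⟩
    rw [Finset.card_insert_of_notMem ht] at this
    omega
  have hsum : ∑ v ∈ A, N.net X v = N.net X s := by
    refine Finset.sum_eq_single_of_mem s hsA fun v hv hvs => hX v hvs ?_
    rintro rfl
    exact htA hv
  have hcut : {e : E | N.tail e ∈ (A : Set V) ∧ N.head e ∉ (A : Set V)}.ncard =
      (X.filter fun e => N.tail e ∈ A ∧ N.head e ∉ A).card := by
    rw [← Set.ncard_coe_finset]
    congr 1
    ext e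
    simp only [Set.mem_ofPred_eq, Finset.mem_coe, Finset.mem_filter]
    exact ⟨fun h => ⟨hout e h.1 h.2, h⟩, fun h => h.2⟩
  have hle : N.minCut s t ≤ (X.filter fun e => N.tail e ∈ A ∧ N.head e ∉ A).card :=
    Nat.sInf_le ⟨A, hsA, htA, hcut⟩
  refine (Int.ofNat_le.2 hle).trans (le_of_eq ?_)
  rw [← hsum, sum_net, Finset.card_filter]
  push_cast
  refine Finset.sum_congr rfl fun e he => ?_
  have := hin e he
  by_cases h1 : N.tail e ∈ A <;> by_cases h2 : N.head e ∈ A <;> simp_all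

/-- The relation is reversed: induction supplies the claim at nodes reachable from the current one,
and a minimal element is a node from which no other node of the set can be reached. -/
theorem wellFounded_precedes [Finite V] : WellFounded fun y x : V =>
    Relation.TransGen (fun x y => ∃ e : E, N.tail e = x ∧ N.head e = y) x y := by
  have : Std.Irrefl fun y x : V =>
    Relation.TransGen (fun x y => ∃ e : E, N.tail e = x ∧ N.head e = y) x y := ⟨N.acyclic⟩
  have : IsTrans V fun y x : V =>
    Relation.TransGen (fun x y => ∃ e : E, N.tail e = x ∧ N.head e = y) x y :=
    ⟨fun _ _ _ h1 h2 => h2.trans h1⟩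
  exact Finite.wellFounded_of_trans_of_irrefl _

open Classical in
-- A node with positive net outflow has an outgoing channel in `X`. Deleting it moves the surplus
-- unit to its head, where the argument repeats; acyclicity makes it stop at `t`. Requiring only
-- nonnegative net outflow, not conservation, is what makes the induction close.
theorem exists_path_of_net [Finite V] {t : V} (u : V) :
    ∀ X : Finset E, u ≠ t → (∀ v, v ≠ t → 0 ≤ N.net X v) → 1 ≤ N.net X u →
      ∃ p : List E, N.IsPath u t p ∧ (∀ e ∈ p, e ∈ X) ∧
        ∀ v, N.net (X \ p.toFinset) v =
          N.net X v - (if u = v then 1 else 0) + (if t = v then 1 else 0) := by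
  induction u using N.wellFounded_precedes.induction with
  | _ u ih =>
  intro X hut hX hu
  obtain ⟨e, he, rfl⟩ : ∃ e ∈ X, N.tail e = u := by
    by_contra! h
    have : N.net X u ≤ 0 := Finset.sum_nonpos fun e he => by
      rw [if_neg (h e he)]; split_ifs <;> simp
    omega
  by_cases hht : N.head e = t
  · refine ⟨[e], ⟨by simp, rfl, hht, by simp⟩, by simpa using he, fun v => ?_⟩
    rw [List.toFinset_cons, List.toFinset_nil, insert_empty_eq, Finset.sdiff_singleton_eq_erase,
      N.net_erase he, hht]
    ring
  · have hX' : ∀ v, v ≠ t → 0 ≤ N.net (X.erase e) v := by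
      intro v hv
      rw [N.net_erase he]
      have := hX v hv
      by_cases h : N.tail e = v
      · subst h
        rw [if_pos rfl]
        split_ifs <;> omega
      · rw [if_neg h]
        split_ifs <;> omega
    obtain ⟨p, ⟨hne, hp1, hp2, hp3⟩, hpX, hpn⟩ :=
      ih (N.head e) (.single ⟨e, rfl, rfl⟩) (X.erase e) hht hX' (by
        rw [N.net_erase he, if_neg (N.tail_ne_head e), if_pos rfl]
        have := hX _ hht
        omega)
    refine ⟨e :: p, ⟨by simp, rfl, ?_, ?_⟩, ?_, fun v => ?_⟩
    · rw [List.getLast_cons hne, hp2]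
    · refine List.IsChain.cons_of_ne_nil hne hp3 ?_
      exact hp1.symm
    · intro d hd
      rcases List.mem_cons.1 hd with rfl | hd
      · exact he
      · exact Finset.mem_of_mem_erase (hpX d hd)
    · rw [List.toFinset_cons, Finset.sdiff_insert, ← Finset.erase_sdiff_comm, hpn,
        N.net_erase he]
      ring

theorem exists_disjoint_paths_of_net [Finite V] {s t : V} (hst : s ≠ t) (w : ℕ) :
    ∀ X : Finset E, (∀ v, v ≠ t → 0 ≤ N.net X v) → (w : ℤ) ≤ N.net X s →
      ∃ P : Fin w → List E, N.IsDisjointPaths s t P ∧ ∀ j, ∀ e ∈ P j, e ∈ X := by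
  classical
  induction w with
  | zero => exact fun X _ _ => ⟨fun j => j.elim0, ⟨fun j => j.elim0, fun j => j.elim0⟩, fun j => j.elim0⟩
  | succ w ih =>
    intro X hX hs
    push_cast at hs
    obtain ⟨p, hp, hpX, hpn⟩ := N.exists_path_of_net s X hst hX (by omega)
    obtain ⟨P, ⟨hP1, hP2⟩, hPX⟩ := ih (X \ p.toFinset) (fun v hv => by
      rw [hpn, if_neg hv.symm]
      have := hX v hv
      split_ifs with h
      · subst h; omega
      · omega) (by rw [hpn, if_pos rfl, if_neg hst.symm]; omega)
    have hd : ∀ j, p.Disjoint (P j) := fun j e he he' => by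
      have := hPX j e he'
      simp [he] at this
    refine ⟨Fin.cons p P, ⟨fun j => ?_, fun i j hij => ?_⟩, fun j => ?_⟩
    · refine Fin.cases ?_ (fun j => ?_) j
      · simpa using hp
      · simpa using hP1 j
    · induction i using Fin.cases <;> induction j using Fin.cases
      · exact absurd rfl hij
      · simpa using hd _
      · simpa using (hd _).symm
      · rename_i i j
        simpa using hP2 i j fun h => hij (h ▸ rfl)
    · refine Fin.cases ?_ (fun j => ?_) j
      · simpa using hpX
      · intro e he
        exact (Finset.mem_sdiff.1 (hPX j e (by simpa using he))).1

/-- Menger's theorem for channel-disjoint paths. -/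
theorem exists_disjoint_paths [Fintype V] [Fintype E] {s t : V} (hst : s ≠ t) {w : ℕ}
    (hw : w ≤ N.minCut s t) : ∃ P : Fin w → List E, N.IsDisjointPaths s t P := by
  obtain ⟨X, hX, hXs⟩ := N.exists_flow hst
  have hws : (w : ℤ) ≤ N.net X s := (Int.ofNat_le.2 hw).trans hXs
  obtain ⟨P, hP, -⟩ := N.exists_disjoint_paths_of_net hst w X (fun v hv => by
    by_cases h : v = s
    · subst h; omega
    · exact (hX v h hv).ge) hws
  exact ⟨P, hP⟩

/-- Menger's theorem shows that the set in `minInternal` is nonempty, so its infimum is attained and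
is not the default `0`. -/
theorem exists_paths_minInternal [Fintype V] [Fintype E] {s t : V} (hst : s ≠ t) {w : ℕ}
    (hw : w ≤ N.minCut s t) : ∃ P : Fin w → List E, N.IsDisjointPaths s t P ∧
      (N.internalNodes s t P).ncard = N.minInternal s w t := by
  obtain ⟨P, hP⟩ := N.exists_disjoint_paths hst hw
  exact Nat.sInf_mem (s := {r : ℕ | ∃ P : Fin w → List E, N.IsDisjointPaths s t P ∧
    (N.internalNodes s t P).ncard = r}) ⟨_, P, hP, rfl⟩

end Menger

end Network

/-! ### Minimising a product of union-bound factors. -/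

section Numeric

/-- `max 0 (1 - n * a)` bounds from below the probability that none of `n` events of probability
at most `a` occurs. -/
noncomputable def unionFactor (a : ℝ) (n : ℕ) : ℝ := max 0 (1 - n * a)

theorem unionFactor_nonneg (a : ℝ) (n : ℕ) : 0 ≤ unionFactor a n := le_max_left _ _

theorem unionFactor_le_one {a : ℝ} (ha : 0 ≤ a) (n : ℕ) : unionFactor a n ≤ 1 :=
  max_le zero_le_one (by have := mul_nonneg (Nat.cast_nonneg (α := ℝ) n) ha; linarith)

theorem unionFactor_zero (a : ℝ) : unionFactor a 0 = 1 := by simp [unionFactor]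

theorem unionFactor_add_le {a : ℝ} (ha : 0 ≤ a) (m n : ℕ) :
    unionFactor a (m + n) ≤ unionFactor a m * unionFactor a n := by
  refine max_le (mul_nonneg (unionFactor_nonneg _ _) (unionFactor_nonneg _ _)) ?_
  have hm := mul_nonneg (Nat.cast_nonneg (α := ℝ) m) ha
  have hn := mul_nonneg (Nat.cast_nonneg (α := ℝ) n) ha
  by_cases h : (1 - ((m + n : ℕ) : ℝ) * a) ≤ 0
  · exact h.trans (mul_nonneg (unionFactor_nonneg _ _) (unionFactor_nonneg _ _))
  · push_cast at h ⊢
    rw [unionFactor, unionFactor, max_eq_right (by nlinarith), max_eq_right (by nlinarith)]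
    nlinarith [mul_nonneg hm hn]

/-- With a fixed sum, the product drops when the two sizes are pushed apart: for `k = m + n - l` the
difference of the two sides is `a² (l - m) (l - n)`. -/
theorem unionFactor_exchange {a : ℝ} (ha : 0 ≤ a) {l m n k : ℕ} (hm : m ≤ l) (hn : n ≤ l)
    (h : m + n = l + k) :
    unionFactor a l * unionFactor a k ≤ unionFactor a m * unionFactor a n := by
  by_cases hl : 1 - (l : ℝ) * a ≤ 0
  · rw [unionFactor, max_eq_left hl, zero_mul]
    exact mul_nonneg (unionFactor_nonneg _ _) (unionFactor_nonneg _ _)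
  · have hm' : (m : ℝ) ≤ l := by exact_mod_cast hm
    have hn' : (n : ℝ) ≤ l := by exact_mod_cast hn
    have hk' : (k : ℝ) ≤ l := by exact_mod_cast (by omega : k ≤ l)
    have h' : (k : ℝ) = m + n - l := by
      have : (m : ℝ) + n = l + k := by exact_mod_cast h
      linarith
    have key : ∀ x : ℕ, (x : ℝ) ≤ l → unionFactor a x = 1 - x * a := fun x hx =>
      max_eq_right (by nlinarith)
    rw [key l le_rfl, key k hk', key m hm', key n hn', h']
    nlinarith [mul_nonneg (mul_nonneg ha ha) (mul_nonneg (sub_nonneg.2 hm') (sub_nonneg.2 hn'))]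

/-- The least value of `∏ unionFactor a (n v)` when all `n v ≤ l` and `∑ n v = N`. -/
noncomputable def worstProduct (a : ℝ) (l N : ℕ) : ℝ :=
  unionFactor a l ^ (N / l) * unionFactor a (N % l)

theorem worstProduct_nonneg (a : ℝ) (l N : ℕ) : 0 ≤ worstProduct a l N :=
  mul_nonneg (pow_nonneg (unionFactor_nonneg _ _) _) (unionFactor_nonneg _ _)

theorem worstProduct_add_le {a : ℝ} (ha : 0 ≤ a) {l : ℕ} (hl : 0 < l) {n : ℕ} (hn : n ≤ l)
    (N : ℕ) : worstProduct a l (n + N) ≤ unionFactor a n * worstProduct a l N := by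
  have hN : N % l < l := Nat.mod_lt _ hl
  have hdiv := Nat.div_add_mod N l
  have hpow : 0 ≤ unionFactor a l ^ (N / l) := pow_nonneg (unionFactor_nonneg _ _) _
  -- Either the new block fits into the incomplete one and the two merge, or it overflows and the
  -- exchange creates a further full block of size `l`.
  by_cases h : n + N % l < l
  · have h1 : (n + N) / l = N / l ∧ (n + N) % l = n + N % l :=
      (Nat.div_mod_unique hl).2 ⟨by omega, h⟩
    rw [worstProduct, worstProduct, h1.1, h1.2]
    calc _ ≤ unionFactor a l ^ (N / l) * (unionFactor a n * unionFactor a (N % l)) :=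
          mul_le_mul_of_nonneg_left (unionFactor_add_le ha _ _) hpow
      _ = _ := by ring
  · obtain ⟨k, hk⟩ := Nat.exists_eq_add_of_le (not_lt.1 h)
    have h1 : (n + N) / l = N / l + 1 ∧ (n + N) % l = k :=
      (Nat.div_mod_unique hl).2 ⟨by rw [mul_add]; omega, by omega⟩
    rw [worstProduct, worstProduct, h1.1, h1.2]
    calc _ = unionFactor a l ^ (N / l) * (unionFactor a l * unionFactor a k) := by ring
      _ ≤ unionFactor a l ^ (N / l) * (unionFactor a n * unionFactor a (N % l)) :=
          mul_le_mul_of_nonneg_left (unionFactor_exchange ha hn hN.le hk) hpow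
      _ = _ := by ring

theorem worstProduct_antitone {a : ℝ} (ha : 0 ≤ a) {l : ℕ} (hl : 0 < l) :
    Antitone (worstProduct a l) := antitone_nat_of_succ_le fun N => by
  rw [add_comm]
  exact (worstProduct_add_le ha hl hl N).trans
    (mul_le_of_le_one_left (worstProduct_nonneg _ _ _) (unionFactor_le_one ha _))

theorem worstProduct_le_prod {a : ℝ} (ha : 0 ≤ a) {l : ℕ} (hl : 0 < l) {ι : Type*}
    (S : Finset ι) (n : ι → ℕ) (hn : ∀ i ∈ S, n i ≤ l) :
    worstProduct a l (∑ i ∈ S, n i) ≤ ∏ i ∈ S, unionFactor a (n i) := by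
  classical
  induction S using Finset.induction_on with
  | empty => simp [worstProduct, unionFactor_zero]
  | insert i S hi ih =>
    rw [Finset.sum_insert hi, Finset.prod_insert hi]
    exact (worstProduct_add_le ha hl (hn i (Finset.mem_insert_self _ _)) _).trans
      (mul_le_mul_of_nonneg_left (ih fun j hj => hn j (Finset.mem_insert_of_mem hj))
        (unionFactor_nonneg _ _))

end Numeric

/-! ### Probabilities as counts: union bound and conditioning on fibres. -/

section Counting

/-- The number of points of a finite type that satisfy `p`, as a real number. -/
noncomputable def cnt {Ω : Type*} (p : Ω → Prop) : ℝ := Nat.card {x // p x}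

variable {Ω : Type*} [Fintype Ω]

open Classical in
theorem cnt_eq_sum (p : Ω → Prop) : cnt p = ∑ x, if p x then 1 else 0 := by
  rw [cnt, Finset.sum_boole, Nat.card_eq_fintype_card, Fintype.card_subtype]

theorem cnt_nonneg (p : Ω → Prop) : 0 ≤ cnt p := Nat.cast_nonneg _

theorem cnt_mono {p q : Ω → Prop} (h : ∀ x, p x → q x) : cnt p ≤ cnt q := by
  classical
  rw [cnt_eq_sum, cnt_eq_sum]
  refine Finset.sum_le_sum fun x _ => ?_
  by_cases hp : p x
  · rw [if_pos hp, if_pos (h x hp)]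
  · rw [if_neg hp]; split_ifs <;> simp

theorem cnt_congr {p q : Ω → Prop} (h : ∀ x, p x ↔ q x) : cnt p = cnt q :=
  le_antisymm (cnt_mono fun x => (h x).1) (cnt_mono fun x => (h x).2)

theorem cnt_eq_zero {p : Ω → Prop} (h : ∀ x, ¬ p x) : cnt p = 0 := by
  classical
  rw [cnt_eq_sum]
  exact Finset.sum_eq_zero fun x _ => if_neg (h x)

theorem cnt_true : cnt (fun _ : Ω => True) = Nat.card Ω := by
  rw [cnt_eq_sum]
  simp

theorem cnt_and_add_cnt_not (p q : Ω → Prop) :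
    cnt (fun x => p x ∧ q x) + cnt (fun x => p x ∧ ¬ q x) = cnt p := by
  classical
  rw [cnt_eq_sum, cnt_eq_sum, cnt_eq_sum, ← Finset.sum_add_distrib]
  refine Finset.sum_congr rfl fun x _ => ?_
  by_cases hp : p x <;> by_cases hq : q x <;> simp [hp, hq]

/-- A union bound relative to the event `p`. -/
theorem cnt_forall_ge {τ : Type*} (p : Ω → Prop) (B : Finset τ) (q : τ → Ω → Prop) {c : ℝ}
    (h : ∀ t ∈ B, (1 - c) * cnt p ≤ cnt fun x => p x ∧ q t x) :
    (1 - B.card * c) * cnt p ≤ cnt fun x => p x ∧ ∀ t ∈ B, q t x := by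
  classical
  induction B using Finset.induction_on with
  | empty => simp
  | insert t B ht ih =>
    have h1 := ih fun t' ht' => h t' (Finset.mem_insert_of_mem ht')
    have h2 := h t (Finset.mem_insert_self _ _)
    have h3 := cnt_and_add_cnt_not p (q t)
    have h4 := cnt_and_add_cnt_not (fun x => p x ∧ ∀ t ∈ B, q t x) (q t)
    have h5 : cnt (fun x => (p x ∧ ∀ t ∈ B, q t x) ∧ ¬ q t x) ≤ cnt fun x => p x ∧ ¬ q t x :=
      cnt_mono fun x hx => ⟨hx.1.1, hx.2⟩
    have h6 : cnt (fun x => (p x ∧ ∀ t ∈ B, q t x) ∧ q t x) =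
        cnt fun x => p x ∧ ∀ t' ∈ insert t B, q t' x :=
      cnt_congr fun x => by
        rw [Finset.forall_mem_insert]; tauto
    rw [Finset.card_insert_of_notMem ht]
    push_cast
    linarith

theorem cnt_le_of_fiber {Y Z : Type*} [Fintype Y] [Fintype Z] (e : Ω ≃ Y × Z) {p q : Ω → Prop}
    {c : ℝ} (h : ∀ z, c * cnt (fun y => p (e.symm (y, z))) ≤ cnt fun y => q (e.symm (y, z))) :
    c * cnt p ≤ cnt q := by
  classical
  have key : ∀ r : Ω → Prop, cnt r = ∑ z, cnt fun y => r (e.symm (y, z)) := by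
    intro r
    rw [cnt_eq_sum, ← Equiv.sum_comp e.symm, Fintype.sum_prod_type_right]
    exact Finset.sum_congr rfl fun z _ => (cnt_eq_sum _).symm
  rw [key p, key q, Finset.mul_sum]
  exact Finset.sum_le_sum fun z _ => h z

end Counting

/-! ### Replacing members of a basis by random vectors. -/

section Exchange

variable {F : Type*} [Field F] [Fintype F]

variable (F) in
/-- The probability that a uniformly random `n × n` matrix over `F` is invertible. -/
noncomputable def invProb (n : ℕ) : ℝ := ∏ h ∈ Finset.Icc 1 n, (1 - 1 / (Fintype.card F : ℝ) ^ h)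

theorem one_div_card_pow_lt_one {h : ℕ} (hh : h ≠ 0) : 1 / (Fintype.card F : ℝ) ^ h < 1 := by
  have h1 : (1 : ℝ) < Fintype.card F := by exact_mod_cast Fintype.one_lt_card
  rw [div_lt_one (by positivity)]
  exact one_lt_pow₀ h1 hh

variable (F) in
theorem invProb_zero : invProb F 0 = 1 := by simp [invProb]

variable (F) in
theorem invProb_succ (n : ℕ) :
    invProb F (n + 1) = invProb F n * (1 - 1 / (Fintype.card F : ℝ) ^ (n + 1)) :=
  Finset.prod_Icc_succ_top (by omega) _

variable (F) in
theorem invProb_pos (n : ℕ) : 0 < invProb F n :=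
  Finset.prod_pos fun h hh => sub_pos.2 <| one_div_card_pow_lt_one <| by
    have := (Finset.mem_Icc.1 hh).1
    omega

variable (F) in
theorem invProb_antitone : Antitone (invProb F) := antitone_nat_of_succ_le fun n => by
  rw [invProb_succ]
  exact mul_le_of_le_one_right (invProb_pos F n).le (sub_le_self _ (by positivity))

variable {M W : Type*} [AddCommGroup M] [Module F M] [Fintype M] [AddCommGroup W] [Module F W]
  [Finite W]

theorem card_mul_card_le_card_mul_card_inf (U L : Submodule F M) :
    Nat.card U * Nat.card L ≤ Nat.card M * Nat.card (U ⊓ L : Submodule F M) := by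
  rw [Module.natCard_eq_pow_finrank (K := F) (V := U), Module.natCard_eq_pow_finrank (K := F) (V := L),
    Module.natCard_eq_pow_finrank (K := F) (V := M),
    Module.natCard_eq_pow_finrank (K := F) (V := (U ⊓ L : Submodule F M)), ← pow_add, ← pow_add]
  refine Nat.pow_le_pow_right Nat.card_pos ?_
  rw [← Submodule.finrank_sup_add_finrank_inf_eq]
  exact Nat.add_le_add_right (Submodule.finrank_le _) _

/-- The event `D` is impossible, certain, or the complement of a subspace. -/
def IsAvoidance (F : Type*) [Field F] {M : Type*} [AddCommGroup M] [Module F M]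
    (D : M → Prop) : Prop :=
  (∀ x, ¬ D x) ∨ (∀ x, D x) ∨ ∃ L : Submodule F M, ∀ x, D x ↔ x ∉ L

/-- Without `D`, a uniform vector lies in a subspace of codimension `h` with probability `q ^ (-h)`,
where `q = |F|`. Membership in `U` and in `L` are nonnegatively correlated because `dim (U + L) ≤
dim M`, so conditioning on `x ∉ L` can only lower the chance of `x ∈ U`. -/
theorem cnt_avoid_subspace {D : M → Prop} (hD : IsAvoidance F D) (U : Submodule F M) {h : ℕ}
    (hU : Module.finrank F U + h = Module.finrank F M) :
    (1 - 1 / (Fintype.card F : ℝ) ^ h) * cnt D ≤ cnt fun x => D x ∧ x ∉ U := by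
  have hq : (0 : ℝ) < (Fintype.card F : ℝ) ^ h := by
    have : 0 < Fintype.card F := Fintype.card_pos
    positivity
  have hUM : (Nat.card U : ℝ) * (Fintype.card F : ℝ) ^ h = Nat.card M := by
    rw [Module.natCard_eq_pow_finrank (K := F) (V := U),
      Module.natCard_eq_pow_finrank (K := F) (V := M), ← hU, Nat.card_eq_fintype_card]
    push_cast
    ring
  have hM : (0 : ℝ) < Nat.card M := by exact_mod_cast Nat.card_pos
  have hU' : cnt (fun x => x ∈ U) = Nat.card U := rfl
  have hT : cnt (fun _ : M => True) = Nat.card M := cnt_true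
  have key : cnt (fun x => D x ∧ x ∈ U) * Nat.card M ≤ Nat.card U * cnt D := by
    rcases hD with hD | hD | ⟨L, hD⟩
    · rw [cnt_eq_zero fun x hx => hD x hx.1, cnt_eq_zero hD]; simp
    · rw [cnt_congr (q := fun x => x ∈ U) fun x => by simp [hD], hU',
        cnt_congr (q := fun _ => True) fun x => by simp [hD], hT]
    · have h1 : cnt (fun x => D x ∧ x ∈ U) = Nat.card U - Nat.card (U ⊓ L : Submodule F M) := by
        have := cnt_and_add_cnt_not (fun x => x ∈ U) fun x => x ∈ L
        rw [hU', show cnt (fun x => x ∈ U ∧ x ∈ L) = Nat.card {x // x ∈ U ∧ x ∈ L} from rfl] at this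
        rw [← this, cnt_congr (q := fun x => x ∈ U ∧ x ∉ L) fun x => by rw [hD, and_comm]]
        change _ = (Nat.card (U ⊓ L : Submodule F M) : ℝ) + _ - _
        ring
      have h2 : cnt D = Nat.card M - Nat.card L := by
        have := cnt_and_add_cnt_not (fun _ => True) fun x => x ∈ L
        rw [hT, cnt_congr (p := fun x => True ∧ x ∈ L) (q := fun x => x ∈ L) fun x => by simp,
          cnt_congr (p := fun x => True ∧ x ∉ L) (q := D) fun x => by simp [hD],
          show cnt (fun x => x ∈ L) = Nat.card {x // x ∈ L} from rfl] at this
        rw [← this]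
        change _ = (Nat.card L : ℝ) + _ - _
        ring
      have h3 : (Nat.card U : ℝ) * Nat.card L ≤ Nat.card M * Nat.card (U ⊓ L : Submodule F M) := by
        exact_mod_cast card_mul_card_le_card_mul_card_inf U L
      rw [h1, h2]
      nlinarith
  have h4 : cnt (fun x => D x ∧ x ∈ U) ≤ 1 / (Fintype.card F : ℝ) ^ h * cnt D := by
    rw [div_mul_eq_mul_div, one_mul, le_div_iff₀ hq]
    have hUpos : (0 : ℝ) < Nat.card U := by exact_mod_cast Nat.card_pos
    rw [← hUM] at key
    nlinarith
  have h5 := cnt_and_add_cnt_not D fun x => x ∈ U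
  linarith

variable {ι O : Type*}

open Classical in
/-- The family `c` in which the members with index in `J` have been replaced by the vectors
`γ (y (ε i))`. -/
noncomputable def exchanged (γ : M →ₗ[F] W) (c : ι → W) (J : Finset ι) (ε : ι → O) (y : O → M)
    (i : ι) : W :=
  if i ∈ J then γ (y (ε i)) else c i

theorem exchanged_of_mem {γ : M →ₗ[F] W} {c : ι → W} {J : Finset ι} {ε : ι → O} {y : O → M} {i : ι}
    (h : i ∈ J) : exchanged γ c J ε y i = γ (y (ε i)) := if_pos h

theorem exchanged_of_notMem {γ : M →ₗ[F] W} {c : ι → W} {J : Finset ι} {ε : ι → O} {y : O → M}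
    {i : ι} (h : i ∉ J) : exchanged γ c J ε y i = c i := if_neg h

open Classical in
theorem exchanged_update {γ : M →ₗ[F] W} {c : ι → W} {J : Finset ι} {ε : ι → O} {y : O → M}
    {i : ι} {e : O} (h : i ∈ J → ε i ≠ e) (x : M) :
    exchanged γ c J ε (Function.update y e x) i = exchanged γ c J ε y i := by
  by_cases hi : i ∈ J
  · rw [exchanged_of_mem hi, exchanged_of_mem hi, Function.update_of_ne (h hi)]
  · rw [exchanged_of_notMem hi, exchanged_of_notMem hi]

open Classical in
theorem linearIndepOn_exchanged_update {γ : M →ₗ[F] W} {c : ι → W} {J : Finset ι} {ε : ι → O}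
    {y : O → M} {s : Set ι} {e : O} (h : ∀ i ∈ s, i ∈ J → ε i ≠ e) (x : M) :
    LinearIndepOn F (exchanged γ c J ε (Function.update y e x)) s ↔
      LinearIndepOn F (exchanged γ c J ε y) s :=
  linearIndepOn_congr fun i hi => exchanged_update (h i hi) x

open Classical in
-- By injectivity of `ε` on `J`, changing one coordinate moves at most one member of the family. If
-- the others are independent, the condition on the moving vector is that its image avoids their
-- span.
theorem isAvoidance_linearIndepOn {γ : M →ₗ[F] W} {c : ι → W} {J : Finset ι} {ε : ι → O}
    (hε : Set.InjOn ε J) (y : O → M) (e : O) :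
    IsAvoidance F fun x => LinearIndependent F (exchanged γ c J ε (Function.update y e x)) := by
  by_cases he : ∃ j ∈ J, ε j = e
  · obtain ⟨j, hj, rfl⟩ := he
    have hne : ∀ i ∈ ({j}ᶜ : Set ι), i ∈ J → ε i ≠ ε j := fun i hi hiJ h => hi (hε hiJ hj h)
    have key : ∀ x, LinearIndependent F (exchanged γ c J ε (Function.update y (ε j) x)) ↔
        LinearIndepOn F (exchanged γ c J ε y) {j}ᶜ ∧
          x ∉ (Submodule.span F (exchanged γ c J ε y '' {j}ᶜ)).comap γ := by
      intro x
      rw [← linearIndepOn_univ_iff, ← show insert j ({j}ᶜ : Set ι) = Set.univ by ext i; simp [Classical.em], linearIndepOn_insert (by simp),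
        linearIndepOn_exchanged_update hne, Set.image_congr fun i hi => exchanged_update (hne i hi) x,
        exchanged_of_mem hj, Function.update_self, Submodule.mem_comap]
    by_cases h : LinearIndepOn F (exchanged γ c J ε y) {j}ᶜ
    · exact Or.inr (Or.inr ⟨_, fun x => (key x).trans (and_iff_right h)⟩)
    · exact Or.inl fun x hx => h ((key x).1 hx).1
  · push Not at he
    have key : ∀ x, LinearIndependent F (exchanged γ c J ε (Function.update y e x)) ↔
        LinearIndependent F (exchanged γ c J ε y) := fun x => by
      rw [← linearIndepOn_univ_iff, ← linearIndepOn_univ_iff,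
        linearIndepOn_exchanged_update fun i _ hi => he i hi]
    by_cases h : LinearIndependent F (exchanged γ c J ε y)
    · exact Or.inr (Or.inl fun x => (key x).2 h)
    · exact Or.inl fun x hx => h ((key x).1 hx)

variable [Fintype ι] [Fintype O]

open Classical in
-- Let `L` be the span of the members kept so far. The composite of `γ` with `W → W / L` is onto:
-- the basis `c` spans `W`, and each `c i` is either in `L` (`i ∉ J`) or in the range of `γ` (`i ∈
-- J`). So pulling `L` back along `γ` preserves its codimension.
theorem finrank_comap_span_exchanged {γ : M →ₗ[F] W} {c : ι → W} {J : Finset ι} {ε : ι → O}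
    (hι : Fintype.card ι = Module.finrank F W) (hc : LinearIndependent F c)
    (hγ : ∀ j ∈ J, c j ∈ LinearMap.range γ) {K : Finset ι} (hK : K ⊆ J) {y : O → M}
    (hy : LinearIndepOn F (exchanged γ c J ε y) (↑(Jᶜ ∪ K) : Set ι)) :
    Module.finrank F ((Submodule.span F
      (exchanged γ c J ε y '' (↑(Jᶜ ∪ K) : Set ι))).comap γ) + (J.card - K.card) =
      Module.finrank F M := by
  set s : Finset ι := Jᶜ ∪ K with hs
  set L := Submodule.span F (exchanged γ c J ε y '' (s : Set ι)) with hL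
  have hscard : s.card + (J.card - K.card) = Module.finrank F W := by
    have h1 : s.card = Jᶜ.card + K.card := Finset.card_union_of_disjoint
      (Finset.disjoint_left.2 fun i hi hiK => Finset.mem_compl.1 hi (hK hiK))
    have h2 := Finset.card_compl_add_card J
    have h3 := Finset.card_le_card hK
    omega
  have hLcard : Module.finrank F L = s.card := by
    have := finrank_span_eq_card (R := F) (b := fun i : s => exchanged γ c J ε y i) hy
    rw [Fintype.card_coe] at this
    rw [← this, hL, Set.image_eq_range]
    rfl
  have hsurj : Function.Surjective (L.mkQ ∘ₗ γ) := by
    rw [← LinearMap.range_eq_top, LinearMap.range_comp, eq_top_iff, ← Submodule.range_mkQ L,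
      ← Submodule.map_top, ← hc.span_eq_top_of_card_eq_finrank' hι, Submodule.map_span,
      Submodule.span_le]
    rintro _ ⟨_, ⟨i, rfl⟩, rfl⟩
    by_cases hi : i ∈ J
    · exact ⟨_, hγ i hi, rfl⟩
    · have : c i ∈ L := Submodule.subset_span ⟨i, by simp [hs, hi], exchanged_of_notMem hi⟩
      rw [(Submodule.Quotient.mk_eq_zero L).2 this |> (show L.mkQ (c i) = 0 from ·)]
      exact Submodule.zero_mem _
  have h1 := LinearMap.finrank_range_add_finrank_ker (L.mkQ ∘ₗ γ)
  have h2 := Submodule.finrank_quotient_add_finrank L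
  rw [LinearMap.range_eq_top.2 hsurj, finrank_top, LinearMap.ker_comp, Submodule.ker_mkQ] at h1
  omega

open Classical in
theorem piSplitAt_symm_eq_update (e : O) (x : M) (z : {o // o ≠ e} → M) :
    (Equiv.piSplitAt e fun _ : O => M).symm (x, z) =
      Function.update ((Equiv.piSplitAt e fun _ : O => M).symm (0, z)) e x := by
  ext o
  by_cases h : o = e
  · subst h; simp
  · simp [h]

open Classical in
/-- Relative to an event that is, in every coordinate, an avoidance event, the exchanged family
stays linearly independent with probability at least `invProb F J.card`. -/
theorem cnt_and_linearIndependent_exchanged {γ : M →ₗ[F] W} {c : ι → W} {J : Finset ι} {ε : ι → O}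
    (hι : Fintype.card ι = Module.finrank F W) (hc : LinearIndependent F c)
    (hγ : ∀ j ∈ J, c j ∈ LinearMap.range γ) (hε : Set.InjOn ε J) {D : (O → M) → Prop}
    (hD : ∀ y e, IsAvoidance F fun x => D (Function.update y e x)) :
    invProb F J.card * cnt D ≤
      cnt fun y => D y ∧ LinearIndependent F (exchanged γ c J ε y) := by
  -- Discard all members indexed by `J` and put the random ones back one at a time. With `K`
  -- restored, the next vector must avoid a subspace of codimension `|J| - |K|`, which contributes
  -- the top factor of `invProb F (|J| - |K|)`.
  have key : ∀ K : Finset ι, K ⊆ J → invProb F J.card * cnt D ≤ invProb F (J.card - K.card) *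
      cnt fun y => D y ∧ LinearIndepOn F (exchanged γ c J ε y) (↑(Jᶜ ∪ K) : Set ι) := by
    intro K
    induction K using Finset.induction_on with
    | empty =>
      intro _
      refine le_of_eq ?_
      rw [Finset.card_empty, Nat.sub_zero]
      congr 1
      refine cnt_congr fun y => (and_iff_left ?_).symm
      rw [Finset.union_empty]
      exact (linearIndepOn_congr fun i hi =>
        exchanged_of_notMem (by simpa using hi)).2 (hc.linearIndepOn _)
    | insert j K hj ih =>
      intro hK
      have hjJ : j ∈ J := hK (Finset.mem_insert_self _ _)
      have hKJ : K ⊆ J := (Finset.subset_insert _ _).trans hK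
      have hlt : K.card < J.card := by
        have := Finset.card_le_card hK
        rw [Finset.card_insert_of_notMem hj] at this
        omega
      obtain ⟨r, hr⟩ : ∃ r, J.card - K.card = r + 1 := ⟨J.card - K.card - 1, by omega⟩
      have hr' : J.card - (insert j K).card = r := by
        rw [Finset.card_insert_of_notMem hj]; omega
      refine (ih hKJ).trans ?_
      rw [hr, hr', invProb_succ, mul_assoc]
      refine mul_le_mul_of_nonneg_left ?_ (invProb_pos F r).le
      have hjs : j ∉ (↑(Jᶜ ∪ K) : Set ι) := by simp [hjJ, hj]
      have hne : ∀ i ∈ (↑(Jᶜ ∪ K) : Set ι), i ∈ J → ε i ≠ ε j := by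
        intro i hi hiJ h
        exact hjs (hε hiJ hjJ h ▸ hi)
      have hins : (↑(Jᶜ ∪ insert j K) : Set ι) = insert j (↑(Jᶜ ∪ K) : Set ι) := by
        rw [Finset.union_insert, Finset.coe_insert]
      refine cnt_le_of_fiber (Equiv.piSplitAt (ε j) fun _ : O => M) fun z => ?_
      obtain ⟨y, hsymm⟩ : ∃ y, ∀ x, (Equiv.piSplitAt (ε j) fun _ : O => M).symm (x, z) =
          Function.update y (ε j) x := ⟨_, fun x => piSplitAt_symm_eq_update (ε j) x z⟩
      simp only [hsymm]
      have hstep : ∀ x, LinearIndepOn F (exchanged γ c J ε (Function.update y (ε j) x))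
          (↑(Jᶜ ∪ insert j K) : Set ι) ↔
            LinearIndepOn F (exchanged γ c J ε y) (↑(Jᶜ ∪ K) : Set ι) ∧
              x ∉ (Submodule.span F (exchanged γ c J ε y '' (↑(Jᶜ ∪ K) : Set ι))).comap γ := by
        intro x
        rw [hins, linearIndepOn_insert hjs, linearIndepOn_exchanged_update hne,
          Set.image_congr fun i hi => exchanged_update (hne i hi) x, exchanged_of_mem hjJ,
          Function.update_self, Submodule.mem_comap]
      have hkeep : ∀ x, LinearIndepOn F (exchanged γ c J ε (Function.update y (ε j) x))
          (↑(Jᶜ ∪ K) : Set ι) ↔ LinearIndepOn F (exchanged γ c J ε y) (↑(Jᶜ ∪ K) : Set ι) :=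
        fun x => linearIndepOn_exchanged_update hne x
      simp only [hstep, hkeep]
      by_cases hy : LinearIndepOn F (exchanged γ c J ε y) (↑(Jᶜ ∪ K) : Set ι)
      · have hU := finrank_comap_span_exchanged hι hc hγ hKJ hy
        rw [hr] at hU
        simpa only [hy, true_and, and_true] using
          cnt_avoid_subspace (hD y (ε j)) _ hU
      · rw [cnt_eq_zero fun x hx => hy hx.2, mul_zero]
        exact cnt_nonneg _
  have h := key J subset_rfl
  rw [Nat.sub_self, invProb_zero, one_mul] at h
  refine h.trans (le_of_eq (cnt_congr fun y => ?_))
  have : (↑(Jᶜ ∪ J) : Set ι) = Set.univ := by ext i; simp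
  rw [this, linearIndepOn_univ_iff]

open Classical in
/-- The simultaneous exchange bound for two groups of families, the first of which uses pairwise
disjoint sets of coordinates. -/
theorem cnt_forall_linearIndependent_exchanged {τ : Type*} (γ : M →ₗ[F] W) (c : τ → ι → W)
    (J : τ → Finset ι) (ε : τ → ι → O) (A B : Finset τ)
    (hι : Fintype.card ι = Module.finrank F W)
    (hc : ∀ t ∈ A ∪ B, LinearIndependent F (c t))
    (hγ : ∀ t ∈ A ∪ B, ∀ j ∈ J t, c t j ∈ LinearMap.range γ)
    (hε : ∀ t ∈ A ∪ B, Set.InjOn (ε t) (J t))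
    (hA : ∀ t ∈ A, ∀ t' ∈ A, t ≠ t' → ∀ j ∈ J t, ∀ j' ∈ J t', ε t j ≠ ε t' j') :
    invProb F (Fintype.card ι) ^ A.card *
        unionFactor (1 - invProb F (Fintype.card ι)) B.card * Nat.card (O → M) ≤
      cnt fun y : O → M =>
        ∀ t ∈ A ∪ B, LinearIndependent F (exchanged γ (c t) (J t) (ε t) y) := by
  have hpos := invProb_pos F (Fintype.card ι)
  -- A coordinate is used by at most one `t ∈ A`, so varying it affects a single family. For `B`
  -- this may fail, hence the union bound there.
  have havoid : ∀ A' ⊆ A, ∀ y e, IsAvoidance F fun x => ∀ t ∈ A',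
      LinearIndependent F (exchanged γ (c t) (J t) (ε t) (Function.update y e x)) := by
    intro A' hA' y e
    have hA'' : ∀ t ∈ A', t ∈ A ∪ B := fun t ht => Finset.mem_union_left _ (hA' ht)
    by_cases h : ∃ t ∈ A', ∃ j ∈ J t, ε t j = e
    · obtain ⟨t, ht, j, hj, rfl⟩ := h
      have key : ∀ x, (∀ t' ∈ A', LinearIndependent F (exchanged γ (c t') (J t') (ε t')
            (Function.update y (ε t j) x))) ↔
          (∀ t' ∈ A', t' ≠ t → LinearIndependent F (exchanged γ (c t') (J t') (ε t') y)) ∧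
            LinearIndependent F (exchanged γ (c t) (J t) (ε t) (Function.update y (ε t j) x)) := by
        intro x
        have h1 : ∀ t' ∈ A', t' ≠ t → (LinearIndependent F (exchanged γ (c t') (J t') (ε t')
            (Function.update y (ε t j) x)) ↔
              LinearIndependent F (exchanged γ (c t') (J t') (ε t') y)) := fun t' ht' hne => by
          rw [← linearIndepOn_univ_iff, ← linearIndepOn_univ_iff, linearIndepOn_exchanged_update]
          exact fun i _ hi => hA t' (hA' ht') t (hA' ht) hne i hi j hj
        refine ⟨fun H => ⟨fun t' ht' hne => (h1 t' ht' hne).1 (H t' ht'), H t ht⟩,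
          fun H t' ht' => ?_⟩
        by_cases hne : t' = t
        · exact hne ▸ H.2
        · exact (h1 t' ht' hne).2 (H.1 t' ht' hne)
      by_cases hrest : ∀ t' ∈ A', t' ≠ t →
          LinearIndependent F (exchanged γ (c t') (J t') (ε t') y)
      · have : (fun x => ∀ t' ∈ A', LinearIndependent F (exchanged γ (c t') (J t') (ε t')
            (Function.update y (ε t j) x))) = fun x => LinearIndependent F
              (exchanged γ (c t) (J t) (ε t) (Function.update y (ε t j) x)) := by
          ext x
          rw [key, and_iff_right hrest]
        rw [this]
        exact isAvoidance_linearIndepOn (hε t (hA'' t ht)) y _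
      · exact Or.inl fun x hx => hrest ((key x).1 hx).1
    · push Not at h
      have key : ∀ x, (∀ t' ∈ A', LinearIndependent F (exchanged γ (c t') (J t') (ε t')
          (Function.update y e x))) ↔
            ∀ t' ∈ A', LinearIndependent F (exchanged γ (c t') (J t') (ε t') y) := by
        refine fun x => forall₂_congr fun t' ht' => ?_
        rw [← linearIndepOn_univ_iff, ← linearIndepOn_univ_iff, linearIndepOn_exchanged_update]
        exact fun i _ hi => h t' ht' i hi
      by_cases hrest : ∀ t' ∈ A', LinearIndependent F (exchanged γ (c t') (J t') (ε t') y)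
      · exact Or.inr (Or.inl fun x => (key x).2 hrest)
      · exact Or.inl fun x hx => hrest ((key x).1 hx)
  have hone : ∀ A' ⊆ A, ∀ t ∈ A ∪ B, invProb F (Fintype.card ι) * cnt (fun y : O → M => ∀ t ∈ A',
      LinearIndependent F (exchanged γ (c t) (J t) (ε t) y)) ≤ cnt fun y : O → M => (∀ t ∈ A',
        LinearIndependent F (exchanged γ (c t) (J t) (ε t) y)) ∧
          LinearIndependent F (exchanged γ (c t) (J t) (ε t) y) := fun A' hA' t ht =>
    (mul_le_mul_of_nonneg_right (invProb_antitone F (Finset.card_le_univ _)) (cnt_nonneg _)).trans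
      (cnt_and_linearIndependent_exchanged hι (hc t ht) (hγ t ht) (hε t ht) (havoid A' hA'))
  have hAbound : ∀ A' ⊆ A, invProb F (Fintype.card ι) ^ A'.card * Nat.card (O → M) ≤
      cnt fun y : O → M => ∀ t ∈ A',
        LinearIndependent F (exchanged γ (c t) (J t) (ε t) y) := by
    intro A'
    induction A' using Finset.induction_on with
    | empty => intro _; simpa using (cnt_true (Ω := O → M)).ge
    | insert t A' ht ih =>
      intro hA'
      have h1 := ih ((Finset.subset_insert _ _).trans hA')
      have h2 := hone A' ((Finset.subset_insert _ _).trans hA') t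
        (Finset.mem_union_left _ (hA' (Finset.mem_insert_self _ _)))
      rw [Finset.card_insert_of_notMem ht, pow_succ', mul_assoc]
      refine ((mul_le_mul_of_nonneg_left h1 hpos.le).trans h2).trans (cnt_mono fun y hy => ?_)
      rw [Finset.forall_mem_insert]
      exact ⟨hy.2, hy.1⟩
  have hunion := cnt_forall_ge (c := 1 - invProb F (Fintype.card ι))
    (fun y : O → M => ∀ t ∈ A, LinearIndependent F (exchanged γ (c t) (J t) (ε t) y)) B
    (fun t y => LinearIndependent F (exchanged γ (c t) (J t) (ε t) y)) fun t ht => by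
      rw [sub_sub_cancel]
      exact hone A subset_rfl t (Finset.mem_union_right _ ht)
  have hmono : cnt (fun y : O → M => (∀ t ∈ A, LinearIndependent F
      (exchanged γ (c t) (J t) (ε t) y)) ∧ ∀ t ∈ B, LinearIndependent F
        (exchanged γ (c t) (J t) (ε t) y)) ≤ cnt fun y : O → M =>
          ∀ t ∈ A ∪ B, LinearIndependent F (exchanged γ (c t) (J t) (ε t) y) :=
    cnt_mono fun y hy t ht => (Finset.mem_union.1 ht).elim (hy.1 t) (hy.2 t)
  refine le_trans ?_ hmono
  -- The lower bound for `A` can be multiplied into the union bound only when this factor is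
  -- nonnegative; otherwise the claim is trivial.
  by_cases h : 1 - (B.card : ℝ) * (1 - invProb F (Fintype.card ι)) ≤ 0
  · rw [unionFactor, max_eq_left h, mul_zero, zero_mul]
    exact cnt_nonneg _
  · rw [unionFactor, max_eq_right (not_le.1 h).le]
    refine le_trans ?_ hunion
    rw [mul_right_comm, mul_comm]
    exact mul_le_mul_of_nonneg_left (hAbound A subset_rfl) (not_le.1 h).le

end Exchange

namespace Network

/-! ### Cuts of paths along predecessor-closed sets of nodes. -/

section Cuts

variable {V E : Type*} (N : Network V E)

/-- There is a nonempty directed path from `x` to `y`. -/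
def Precedes (x y : V) : Prop :=
  Relation.TransGen (fun x y => ∃ e : E, N.tail e = x ∧ N.head e = y) x y

variable {N}

theorem Precedes.ne {x y : V} (h : N.Precedes x y) : x ≠ y := by
  rintro rfl
  exact N.acyclic _ h

theorem precedes_of_head_eq_tail {d e : E} (h : N.head d = N.tail e) :
    N.Precedes (N.tail d) (N.tail e) := .single ⟨d, rfl, h⟩

theorem pairwise_precedes {p : List E} (h : p.IsChain fun d e => N.head d = N.tail e) :
    p.Pairwise fun d e => N.Precedes (N.tail d) (N.tail e) := by
  have : IsTrans E fun d e => N.Precedes (N.tail d) (N.tail e) := ⟨fun _ _ _ h1 h2 => h1.trans h2⟩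
  exact List.isChain_iff_pairwise.1 (h.imp fun _ _ => precedes_of_head_eq_tail)

theorem IsPath.precedes {s t : V} {p : List E} (hp : N.IsPath s t p) {e : E} (he : e ∈ p) :
    N.Precedes (N.tail e) t := by
  obtain ⟨hne, -, ht, hc⟩ := hp
  have h1 := pairwise_precedes hc
  rw [← List.dropLast_append_getLast hne] at h1 he
  have hlast : N.Precedes (N.tail (p.getLast hne)) t := .single ⟨_, rfl, ht⟩
  rcases List.mem_append.1 he with he | he
  · exact ((List.pairwise_append.1 h1).2.2 e he _ (List.mem_singleton_self _)).trans hlast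
  · rwa [List.mem_singleton.1 he]

theorem IsPath.head_eq_or {s t : V} {p : List E} (hp : N.IsPath s t p) {e : E} (he : e ∈ p) :
    N.head e = t ∨ ∃ d ∈ p, N.tail d = N.head e := by
  obtain ⟨hne, -, ht, hc⟩ := hp
  obtain ⟨l₁, l₂, rfl⟩ := List.append_of_mem he
  rcases l₂ with _ | ⟨d, l₂⟩
  · left; simpa using ht
  · right
    refine ⟨d, by simp, ?_⟩
    have := (List.isChain_append.1 hc).2.1
    exact (List.isChain_cons_cons.1 this).1.symm

variable (N)

/-- The set `S` contains the tail of every channel whose head it contains. -/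
def IsInitial (S : Finset V) : Prop := ∀ e, N.head e ∈ S → N.tail e ∈ S

theorem IsInitial.mem_of_precedes {S : Finset V} (hS : N.IsInitial S) {x y : V}
    (h : N.Precedes x y) (hy : y ∈ S) : x ∈ S := by
  induction h using Relation.TransGen.head_induction_on with
  | single h => obtain ⟨e, rfl, rfl⟩ := h; exact hS e hy
  | head h _ ih => obtain ⟨e, rfl, rfl⟩ := h; exact hS e ih

theorem exists_maximal_precedes [Finite V] {S : Finset V} (hS : S.Nonempty) :
    ∃ v ∈ S, ∀ x ∈ S, ¬ N.Precedes v x :=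
  N.wellFounded_precedes.has_min S hS

open Classical in
/-- The last channel of the path `p` whose tail is in `S`, where `p` is thought of as starting with
the imaginary channel `j`. -/
noncomputable def cut {w : ℕ} (S : Finset V) (p : List E) (j : Fin w) : Fin w ⊕ E :=
  (p.filter fun e => N.tail e ∈ S).getLast?.elim (.inl j) .inr

theorem tail_mem_of_cut_eq {w : ℕ} {S : Finset V} {p : List E} {j : Fin w} {e : E}
    (h : N.cut S p j = .inr e) : N.tail e ∈ S := by
  classical
  rw [cut] at h
  cases hl : (p.filter fun e => N.tail e ∈ S).getLast? with
  | none => simp [hl] at h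
  | some d =>
    have hd := List.mem_of_getLast? hl
    have : d = e := by simpa [hl] using h
    subst this
    simpa using (List.mem_filter.1 hd).2

theorem cut_empty {w : ℕ} (p : List E) (j : Fin w) : N.cut ∅ p j = .inl j := by
  simp [cut]

theorem cut_univ [Fintype V] {w : ℕ} {p : List E} (hp : p ≠ []) (j : Fin w) :
    N.cut Finset.univ p j = .inr (p.getLast hp) := by
  simp [cut, List.getLast?_eq_some_getLast hp]

open Classical in
theorem cut_insert_of_forall_ne {w : ℕ} {S : Finset V} {v : V} {p : List E} {j : Fin w}
    (h : ∀ e ∈ p, N.tail e ≠ v) : N.cut (insert v S) p j = N.cut S p j := by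
  rw [cut, cut]
  congr 2
  refine List.filter_congr fun e he => ?_
  simp [h e he]

open Classical in
-- As both sets are predecessor-closed and the network is acyclic, the channels of `p` before `e`
-- have tails in `S` and those after it have tails outside `insert v S`. Hence the cut moves from
-- the channel entering `v` to its successor `e`.
theorem cut_of_tail_eq {s t : V} {w : ℕ} {S : Finset V} {v : V} {p : List E} {j : Fin w} {e : E}
    (hp : N.IsPath s t p) (hS : N.IsInitial S) (hvS : N.IsInitial (insert v S)) (hv : v ∉ S)
    (he : e ∈ p) (hev : N.tail e = v) :
    N.cut (insert v S) p j = .inr e ∧ N.extHead s w (N.cut S p j) = v := by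
  obtain ⟨hne, hs, -, hc⟩ := hp
  obtain ⟨l₁, l₂, rfl⟩ := List.append_of_mem he
  have h1 := List.pairwise_append.1 (pairwise_precedes hc)
  have hl₁ : ∀ d ∈ l₁, N.tail d ∈ S := fun d hd => by
    have h2 := h1.2.2 d hd e (List.mem_cons_self ..)
    refine Finset.mem_of_mem_insert_of_ne
      (hvS.mem_of_precedes N h2 (hev ▸ Finset.mem_insert_self _ _)) ?_
    exact hev ▸ h2.ne
  have hl₂ : ∀ d ∈ l₂, N.tail d ∉ insert v S := fun d hd hdS => by
    have h2 := (List.pairwise_cons.1 h1.2.1).1 d hd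
    rcases Finset.mem_insert.1 hdS with h | h
    · exact h2.ne (hev.trans h.symm)
    · exact hv (hev ▸ hS.mem_of_precedes N h2 h)
  have hf : (l₁ ++ e :: l₂).filter (fun e => N.tail e ∈ insert v S) = l₁ ++ [e] := by
    rw [List.filter_append, List.filter_cons_of_pos (by simp [hev]),
      List.filter_eq_self.2 fun d hd => by simp [hl₁ d hd],
      List.filter_eq_nil_iff.2 fun d hd => by simpa using hl₂ d hd]
  have hf' : (l₁ ++ e :: l₂).filter (fun e => N.tail e ∈ S) = l₁ := by
    rw [List.filter_append, List.filter_cons_of_neg (by simp [hev, hv]),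
      List.filter_eq_self.2 fun d hd => by simp [hl₁ d hd],
      List.filter_eq_nil_iff.2 fun d hd => by
        have := hl₂ d hd
        simp only [Finset.mem_insert, not_or] at this
        simpa using this.2, List.append_nil]
  constructor
  · rw [cut, hf]; simp
  · rw [cut, hf']
    rcases List.eq_nil_or_concat l₁ with rfl | ⟨l, d, rfl⟩
    · simp only [List.nil_append, List.head_cons] at hs
      simp [extHead, ← hs, hev]
    · have := (List.isChain_append.1 hc).2.2 d (by simp) e (by simp)
      simp [extHead, this, hev]

end Cuts

/-! ### Passing one node: the exchange bound for encoding kernels. -/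

section Kernels

variable {V E : Type*} (N : Network V E) [Fintype E] {F : Type*} [Field F] {s : V} {w : ℕ}

/-- The global encoding kernels of the real and the imaginary channels. -/
noncomputable def extKernel (k : N.LocalCoeffs s w F) : Fin w ⊕ E → Fin w → F :=
  Sum.elim (fun j => Pi.single j 1) (N.kernel k)

open Classical in
theorem kernel_eq_linearCombination (k : N.LocalCoeffs s w F) {e : E} {v : V} (h : N.tail e = v) :
    N.kernel k e = Fintype.linearCombination F
      (fun d : {d : Fin w ⊕ E // N.extHead s w d = v} => N.extKernel k d.1)
        fun d => k ⟨(d.1, e), d.2.trans h.symm⟩ := by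
  subst h
  rw [kernel_eq, Fintype.linearCombination_apply]
  rfl

theorem kernel_congr {S : Finset V} (hS : N.IsInitial S) {k k' : N.LocalCoeffs s w F}
    (h : ∀ p, N.tail p.1.2 ∈ S → k p = k' p) (e : E) (he : N.tail e ∈ S) :
    N.kernel k e = N.kernel k' e := by
  induction e using N.wellFounded_adj.induction with
  | _ e ih =>
  rw [kernel_eq, kernel_eq]
  refine Finset.sum_congr rfl fun d _ => ?_
  rw [h _ he]
  congr 1
  obtain ⟨d | d, hd⟩ := d
  · rfl
  · exact ih d hd (hS d (by rw [show N.head d = N.tail e from hd]; exact he))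

theorem extKernel_cut_congr {S : Finset V} (hS : N.IsInitial S) {k k' : N.LocalCoeffs s w F}
    (h : ∀ p, N.tail p.1.2 ∈ S → k p = k' p) (p : List E) (j : Fin w) :
    N.extKernel k (N.cut S p j) = N.extKernel k' (N.cut S p j) := by
  cases hd : N.cut S p j with
  | inl i => rfl
  | inr e => exact N.kernel_congr hS h e (N.tail_mem_of_cut_eq hd)

open Classical in
variable (F s w) in
/-- The coefficients at the node `v` and those at all other nodes. -/
noncomputable def splitCoeffs (v : V) : N.LocalCoeffs s w F ≃
    ({e : E // N.tail e = v} → {d : Fin w ⊕ E // N.extHead s w d = v} → F) ×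
      ({p : {p : (Fin w ⊕ E) × E // N.extHead s w p.1 = N.tail p.2} // N.tail p.1.2 ≠ v} → F) where
  toFun k := (fun e d => k ⟨(d.1, e.1), d.2.trans e.2.symm⟩, fun p => k p.1)
  invFun x p := if h : N.tail p.1.2 = v then x.1 ⟨p.1.2, h⟩ ⟨p.1.1, p.2.trans h⟩ else x.2 ⟨p, h⟩
  left_inv k := by
    ext p
    by_cases h : N.tail p.1.2 = v <;> simp [h]
  right_inv x := by
    refine Prod.ext ?_ ?_
    · ext e d; simp [e.2]
    · ext p; simp [p.2]

theorem splitCoeffs_symm_of_eq {v : V}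
    (y : {e : E // N.tail e = v} → {d : Fin w ⊕ E // N.extHead s w d = v} → F) (z)
    {p : {p : (Fin w ⊕ E) × E // N.extHead s w p.1 = N.tail p.2}} (h : N.tail p.1.2 = v) :
    (N.splitCoeffs F s w v).symm (y, z) p = y ⟨p.1.2, h⟩ ⟨p.1.1, p.2.trans h⟩ := dif_pos h

theorem splitCoeffs_symm_of_ne {v : V}
    (y : {e : E // N.tail e = v} → {d : Fin w ⊕ E // N.extHead s w d = v} → F) (z)
    {p : {p : (Fin w ⊕ E) × E // N.extHead s w p.1 = N.tail p.2}} (h : N.tail p.1.2 ≠ v) :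
    (N.splitCoeffs F s w v).symm (y, z) p = z ⟨p, h⟩ := dif_neg h

/-- The kernels of the channels where the paths leave `S` are linearly independent. -/
def CutIndependent (k : N.LocalCoeffs s w F) (S : Finset V) (P : Fin w → List E) : Prop :=
  LinearIndependent F fun j => N.extKernel k (N.cut S (P j) j)

variable [Fintype F]

open Classical in
-- With the coefficients at nodes other than `v` frozen, the kernels entering `v` and those on the
-- old cuts are constant, while each channel leaving `v` has an independent uniform coefficient
-- vector. This is the setting of `cnt_forall_linearIndependent_exchanged`, with `γ` sending a
-- coefficient vector to the resulting kernel.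
theorem cnt_cutIndependent_insert (T : Finset V) (P : V → Fin w → List E)
    (hP : ∀ t ∈ T, N.IsDisjointPaths s t (P t)) {S : Finset V} {v : V} (hS : N.IsInitial S)
    (hvS : N.IsInitial (insert v S)) (hv : v ∉ S) {A B : Finset V} (hAB : A ∪ B ⊆ T)
    (hmem : ∀ t ∈ T, ∀ j, ∀ e ∈ P t j, N.tail e = v → t ∈ A ∪ B)
    (hA : ∀ t ∈ A, ∀ j, ∀ e ∈ P t j, N.tail e = v → N.head e = t) :
    invProb F w ^ A.card * unionFactor (1 - invProb F w) B.card *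
        cnt (fun k : N.LocalCoeffs s w F => ∀ t ∈ T, N.CutIndependent k S (P t)) ≤
      cnt fun k : N.LocalCoeffs s w F => ∀ t ∈ T, N.CutIndependent k (insert v S) (P t) := by
  have hone : invProb F w ≤ 1 := (invProb_antitone F (Nat.zero_le w)).trans (invProb_zero F).le
  have hfac0 : 0 ≤ invProb F w ^ A.card * unionFactor (1 - invProb F w) B.card :=
    mul_nonneg (pow_nonneg (invProb_pos F w).le _) (unionFactor_nonneg _ _)
  have hfac1 : invProb F w ^ A.card * unionFactor (1 - invProb F w) B.card ≤ 1 :=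
    mul_le_one₀ (pow_le_one₀ (invProb_pos F w).le hone) (unionFactor_nonneg _ _)
      (unionFactor_le_one (sub_nonneg.2 hone) _)
  refine cnt_le_of_fiber (N.splitCoeffs F s w v) fun z => ?_
  set κ := fun y => (N.splitCoeffs F s w v).symm (y, z) with hκ
  have hloc : ∀ y p, N.tail p.1.2 ∈ S → κ y p = κ 0 p := fun y p hp => by
    have hne : N.tail p.1.2 ≠ v := fun h => hv (h ▸ hp)
    simp only [hκ]
    rw [N.splitCoeffs_symm_of_ne _ _ hne, N.splitCoeffs_symm_of_ne _ _ hne]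
  have hcut : ∀ y t j, N.extKernel (κ y) (N.cut S (P t j) j) =
      N.extKernel (κ 0) (N.cut S (P t j) j) := fun y t j =>
    N.extKernel_cut_congr hS (hloc y) _ _
  have hin : ∀ y (d : {d : Fin w ⊕ E // N.extHead s w d = v}),
      N.extKernel (κ y) d.1 = N.extKernel (κ 0) d.1 := by
    rintro y ⟨d | d, hd⟩
    · rfl
    · have hd' : N.head d = v := hd
      refine N.kernel_congr hS (hloc y) d (Finset.mem_of_mem_insert_of_ne
        (hvS d (hd' ▸ Finset.mem_insert_self _ _)) ?_)
      exact hd' ▸ N.tail_ne_head d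
  by_cases hgood : ∀ t ∈ T, N.CutIndependent (κ 0) S (P t)
  swap
  · rw [cnt_eq_zero, mul_zero]
    · exact cnt_nonneg _
    · refine fun y hy => hgood fun t ht => ?_
      have := hy t ht
      simp only [CutIndependent] at this ⊢
      simpa only [← hcut y] using this
  have hleft : cnt (fun y => ∀ t ∈ T, N.CutIndependent ((N.splitCoeffs F s w v).symm (y, z)) S (P t))
      ≤ Nat.card ({e : E // N.tail e = v} → {d : Fin w ⊕ E // N.extHead s w d = v} → F) :=
    (cnt_mono fun _ _ => trivial).trans cnt_true.le
  refine (mul_le_mul_of_nonneg_left hleft hfac0).trans ?_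
  have hunused : ∀ y t, (∀ j, ∀ e ∈ P t j, N.tail e ≠ v) → t ∈ T →
      N.CutIndependent (κ y) (insert v S) (P t) := by
    intro y t h ht
    have := hgood t ht
    simp only [CutIndependent] at this ⊢
    simpa only [N.cut_insert_of_forall_ne (h _), hcut y] using this
  -- If no channel leaves `v`, no cut changes; otherwise `ε` has an arbitrary value to take on paths
  -- that do not leave `v`.
  rcases isEmpty_or_nonempty {e : E // N.tail e = v} with hO | hO
  · rw [cnt_congr (q := fun _ => True) fun y => iff_true_intro fun t ht =>
      hunused y t (fun j e _ h => hO.elim ⟨e, h⟩) ht, cnt_true]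
    exact mul_le_of_le_one_left (Nat.cast_nonneg _) hfac1
  have hex : ∀ t j, ∃ e : {e : E // N.tail e = v},
      (∃ e ∈ P t j, N.tail e = v) → e.1 ∈ P t j := fun t j => by
    by_cases h : ∃ e ∈ P t j, N.tail e = v
    · obtain ⟨e, he, hev⟩ := h
      exact ⟨⟨e, hev⟩, fun _ => he⟩
    · exact ⟨Classical.arbitrary _, fun h' => absurd h' h⟩
  choose ε hε using hex
  set J : V → Finset (Fin w) := fun t => Finset.univ.filter fun j => ∃ e ∈ P t j, N.tail e = v
    with hJ
  have hεJ : ∀ t, ∀ j ∈ J t, (ε t j).1 ∈ P t j := fun t j hj =>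
    hε t j (Finset.mem_filter.1 hj).2
  set γ := Fintype.linearCombination F
    (fun d : {d : Fin w ⊕ E // N.extHead s w d = v} => N.extKernel (κ 0) d.1) with hγ
  set c : V → Fin w → Fin w → F := fun t j => N.extKernel (κ 0) (N.cut S (P t j) j) with hc
  have hnode := cnt_forall_linearIndependent_exchanged γ c J ε A B (by simp)
    (fun t ht => hgood t (hAB ht))
    (fun t ht j hj => by
      have h := (N.cut_of_tail_eq (j := j) ((hP t (hAB ht)).1 j) hS hvS hv (hεJ t j hj)
        (ε t j).2).2
      refine ⟨Pi.single ⟨_, h⟩ 1, ?_⟩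
      rw [hγ, Fintype.linearCombination_apply_single, one_smul])
    (fun t ht i hi j hj h => by
      by_contra hij
      exact (hP t (hAB ht)).2 i j hij (hεJ t i hi) (h ▸ hεJ t j hj))
    -- For sinks in `A` the head of such a channel is the sink itself, so a shared channel would
    -- force `t = t'`.
    (fun t ht t' ht' hne j hj j' hj' h => hne <| by
      rw [← hA t ht j _ (hεJ t j hj) (ε t j).2, h,
        hA t' ht' j' _ (hεJ t' j' hj') (ε t' j').2])
  rw [Fintype.card_fin] at hnode
  refine hnode.trans (cnt_mono fun y hy t ht => ?_)
  by_cases htAB : t ∈ A ∪ B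
  · have h1 := hy t htAB
    suffices hfam : (fun j => N.extKernel (κ y) (N.cut (insert v S) (P t j) j)) =
        exchanged γ (c t) (J t) (ε t) y by
      change LinearIndependent F fun j => N.extKernel (κ y) (N.cut (insert v S) (P t j) j)
      rw [hfam]
      exact h1
    ext1 j
    by_cases hj : j ∈ J t
    · rw [exchanged_of_mem hj, (N.cut_of_tail_eq (j := j) ((hP t ht).1 j) hS hvS hv (hεJ t j hj)
        (ε t j).2).1]
      change N.kernel (κ y) _ = _
      rw [N.kernel_eq_linearCombination _ (ε t j).2, hγ, funext (hin y)]
      congr 1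
      ext d
      exact N.splitCoeffs_symm_of_eq y z (p := ⟨(d.1, (ε t j).1), _⟩) (ε t j).2
    · rw [exchanged_of_notMem hj, N.cut_insert_of_forall_ne]
      · exact hcut y t j
      · exact fun e he hev => hj (Finset.mem_filter.2 ⟨Finset.mem_univ _, e, he, hev⟩)
  · exact hunused y t (fun j e he h => htAB (hmem t ht j e he h)) ht

end Kernels

end Network

namespace Network

/-! ### Multiplying the node bounds and counting sinks per node. -/

section Success

variable {V E : Type*} (N : Network V E)

open Classical in
/-- The nodes that are left by some path of the collection `P`. -/
noncomputable def tailNodes [Fintype V] {w : ℕ} (P : Fin w → List E) : Finset V :=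
  Finset.univ.filter fun v => ∃ j, ∃ e ∈ P j, N.tail e = v

theorem mem_tailNodes [Fintype V] {w : ℕ} {P : Fin w → List E} {v : V} :
    v ∈ N.tailNodes P ↔ ∃ j, ∃ e ∈ P j, N.tail e = v := by
  simp [tailNodes]

theorem card_tailNodes_le [Fintype V] {s t : V} {w : ℕ} {P : Fin w → List E}
    (hP : N.IsDisjointPaths s t P) :
    (N.tailNodes P).card ≤ (N.internalNodes s t P).ncard + 1 := by
  classical
  rw [← Set.ncard_coe_finset]
  refine (Set.ncard_le_ncard (t := insert s (N.internalNodes s t P)) ?_ (Set.toFinite _)).trans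
    (Set.ncard_insert_le _ _)
  intro v hv
  obtain ⟨j, e, he, rfl⟩ := N.mem_tailNodes.1 (Finset.mem_coe.1 hv)
  by_cases h : N.tail e = s
  · exact Or.inl h
  · exact Or.inr ⟨h, ((hP.1 j).precedes he).ne, j, e, he, Or.inl rfl⟩

/-- Take a tail node from which no other tail node can be reached: a path channel leaving it cannot
be followed by another one, so it ends at `t`. -/
theorem exists_last_tailNode [Fintype V] {s t : V} {w : ℕ} (hw : 0 < w) {P : Fin w → List E}
    (hP : N.IsDisjointPaths s t P) :
    ∃ v ∈ N.tailNodes P, ∀ j, ∀ e ∈ P j, N.tail e = v → N.head e = t := by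
  obtain ⟨hne, -⟩ := hP.1 ⟨0, hw⟩
  obtain ⟨v, hv, hmax⟩ := N.exists_maximal_precedes (S := N.tailNodes P)
    ⟨_, N.mem_tailNodes.2 ⟨_, _, List.head_mem hne, rfl⟩⟩
  refine ⟨v, hv, fun j e he hev => ?_⟩
  rcases (hP.1 j).head_eq_or he with h | ⟨d, hd, hde⟩
  · exact h
  · exact absurd (.single ⟨e, hev, rfl⟩) (hmax _ (N.mem_tailNodes.2 ⟨j, d, hd, hde⟩))

variable [Fintype E] {F : Type*} [Field F] {s : V} {w : ℕ}

open Classical in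
theorem rank_decodingMatrix_of_cutIndependent [Fintype V] {k : N.LocalCoeffs s w F} {t : V}
    {P : Fin w → List E} (hP : N.IsDisjointPaths s t P)
    (h : N.CutIndependent k Finset.univ P) : w ≤ (N.decodingMatrix k t).rank := by
  classical
  choose hne _ hlast _ using hP.1
  have h1 : LinearIndependent F fun j => N.kernel k ((P j).getLast (hne j)) := by
    have h2 : LinearIndependent F fun j => N.extKernel k (N.cut Finset.univ (P j) j) := h
    simpa only [N.cut_univ (hne _), extKernel, Sum.elim_inr] using h2
  have h3 := finrank_span_eq_card h1
  rw [Fintype.card_fin] at h3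
  rw [Matrix.rank_eq_finrank_span_cols]
  refine h3.ge.trans (Submodule.finrank_mono (Submodule.span_mono ?_))
  rintro _ ⟨j, rfl⟩
  exact ⟨⟨_, hlast j⟩, rfl⟩

variable [Fintype F]

open Classical in
/-- The local bounds multiply up along a linear extension of the order of the nodes. -/
theorem prod_mul_card_le_cnt_cutIndependent [Fintype V] (T : Finset V) (P : V → Fin w → List E)
    (hP : ∀ t ∈ T, N.IsDisjointPaths s t (P t)) (last : V → V)
    (hlast : ∀ t ∈ T, ∀ j, ∀ e ∈ P t j, N.tail e = last t → N.head e = t) (S : Finset V)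
    (hS : N.IsInitial S) :
    (∏ v ∈ S, invProb F w ^ (T.filter fun t => last t = v).card *
        unionFactor (1 - invProb F w)
          (T.filter fun t => v ∈ (N.tailNodes (P t)).erase (last t)).card) *
      Nat.card (N.LocalCoeffs s w F) ≤
        cnt fun k : N.LocalCoeffs s w F => ∀ t ∈ T, N.CutIndependent k S (P t) := by
  induction S using Finset.strongInduction with
  | H S ih =>
  rcases S.eq_empty_or_nonempty with rfl | hne
  · rw [Finset.prod_empty, one_mul, ← cnt_true]
    refine cnt_mono fun k _ t _ => ?_
    change LinearIndependent F fun j => N.extKernel k (N.cut ∅ (P t j) j)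
    simp only [cut_empty, extKernel, Sum.elim_inl]
    exact Pi.linearIndependent_single_one (Fin w) F
  -- Maximality of `v` keeps `S.erase v` closed under predecessors.
  · obtain ⟨v, hv, hmax⟩ := N.exists_maximal_precedes hne
    have hS' : N.IsInitial (S.erase v) := fun e he => by
      have he' := Finset.mem_of_mem_erase he
      exact Finset.mem_erase.2 ⟨fun h => hmax _ he' (.single ⟨e, h, rfl⟩), hS e he'⟩
    have h1 := ih (S.erase v) (Finset.erase_ssubset hv) hS'
    have h2 := N.cnt_cutIndependent_insert (F := F) T P hP hS'
      (by rwa [Finset.insert_erase hv]) (Finset.notMem_erase v S)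
      (A := T.filter fun t => last t = v)
      (B := T.filter fun t => v ∈ (N.tailNodes (P t)).erase (last t))
      (Finset.union_subset (Finset.filter_subset _ _) (Finset.filter_subset _ _))
      (fun t ht j e he hev => by
        by_cases h : last t = v
        · exact Finset.mem_union_left _ (Finset.mem_filter.2 ⟨ht, h⟩)
        · exact Finset.mem_union_right _ (Finset.mem_filter.2 ⟨ht, Finset.mem_erase.2
            ⟨Ne.symm h, N.mem_tailNodes.2 ⟨j, e, he, hev⟩⟩⟩))
      (fun t ht j e he hev => by
        obtain ⟨htT, htv⟩ := Finset.mem_filter.1 ht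
        exact hlast t htT j e he (hev.trans htv.symm))
    rw [Finset.insert_erase hv] at h2
    rw [← Finset.mul_prod_erase S _ hv, mul_assoc]
    exact (mul_le_mul_of_nonneg_left h1 (mul_nonneg (pow_nonneg (invProb_pos F w).le _)
      (unionFactor_nonneg _ _))).trans h2

open Classical in
theorem failureProb_le_one_sub (T : Finset V) {c : ℝ} (h : c * Nat.card (N.LocalCoeffs s w F) ≤
    cnt fun k : N.LocalCoeffs s w F => ∀ t ∈ T, w ≤ (N.decodingMatrix k t).rank) :
    N.failureProb F s w T ≤ 1 - c := by
  classical
  have hpos : (0 : ℝ) < Nat.card (N.LocalCoeffs s w F) := by exact_mod_cast Nat.card_pos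
  have h1 := cnt_and_add_cnt_not (fun _ : N.LocalCoeffs s w F => True)
    fun k => ∀ t ∈ T, w ≤ (N.decodingMatrix k t).rank
  rw [cnt_true] at h1
  simp only [true_and] at h1
  have h2 : cnt (fun k : N.LocalCoeffs s w F => ∃ t ∈ T, (N.decodingMatrix k t).rank < w) =
      cnt fun k : N.LocalCoeffs s w F => ¬ ∀ t ∈ T, w ≤ (N.decodingMatrix k t).rank :=
    cnt_congr fun k => by push Not; rfl
  rw [failureProb, div_le_iff₀ hpos]
  change cnt (fun k : N.LocalCoeffs s w F => ∃ t ∈ T, (N.decodingMatrix k t).rank < w) ≤ _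
  linarith

theorem failureProb_le_worstProduct [Fintype V] {T : Finset V} (hs : s ∉ T)
    (hT : T.Nonempty) (hwpos : 0 < w) (hw : ∀ t ∈ T, w ≤ N.minCut s t) :
    N.failureProb F s w T ≤ 1 - invProb F w ^ T.card *
      worstProduct (1 - invProb F w) T.card (∑ t ∈ T, N.minInternal s w t) := by
  classical
  have ha : 0 ≤ 1 - invProb F w :=
    sub_nonneg.2 ((invProb_antitone F (Nat.zero_le w)).trans (invProb_zero F).le)
  have hpaths : ∀ t ∈ T, ∃ P : Fin w → List E, N.IsDisjointPaths s t P ∧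
      (N.internalNodes s t P).ncard = N.minInternal s w t := fun t ht =>
    N.exists_paths_minInternal (ne_of_mem_of_not_mem ht hs).symm (hw t ht)
  choose! P hP hPcard using hpaths
  have hex : ∀ t ∈ T, ∃ v ∈ N.tailNodes (P t),
      ∀ j, ∀ e ∈ P t j, N.tail e = v → N.head e = t := fun t ht =>
    N.exists_last_tailNode hwpos (hP t ht)
  choose! last hmem hlast using hex
  have hsuccess := N.prod_mul_card_le_cnt_cutIndependent (F := F) T P hP last hlast Finset.univ
    fun e _ => Finset.mem_univ _
  refine N.failureProb_le_one_sub T (le_trans ?_ (hsuccess.trans (cnt_mono fun k hk t ht =>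
    N.rank_decodingMatrix_of_cutIndependent (hP t ht) (hk t ht))))
  refine mul_le_mul_of_nonneg_right ?_ (Nat.cast_nonneg _)
  have hA : ∑ v, (T.filter fun t => last t = v).card = T.card :=
    (Finset.card_eq_sum_card_fiberwise fun t _ => Finset.mem_univ (last t)).symm
  have hB : ∑ v, (T.filter fun t => v ∈ (N.tailNodes (P t)).erase (last t)).card ≤
      ∑ t ∈ T, N.minInternal s w t := by
    have hcount := Finset.sum_card_bipartiteAbove_eq_sum_card_bipartiteBelow
      (s := Finset.univ) (t := T) fun v t => v ∈ (N.tailNodes (P t)).erase (last t)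
    simp only [Finset.bipartiteAbove, Finset.bipartiteBelow, Finset.filter_univ_mem] at hcount
    rw [hcount]
    refine Finset.sum_le_sum fun t ht => ?_
    -- Erasing the last tail node compensates for `s`, which may be a tail node but is not internal.
    rw [Finset.card_erase_of_mem (hmem t ht), ← hPcard t ht]
    exact Nat.sub_le_of_le_add (N.card_tailNodes_le (hP t ht))
  rw [Finset.prod_mul_distrib, Finset.prod_pow_eq_pow_sum, hA]
  refine mul_le_mul_of_nonneg_left ?_ (pow_nonneg (invProb_pos F w).le _)
  exact (worstProduct_antitone ha hT.card_pos hB).trans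
    (worstProduct_le_prod ha hT.card_pos _ _ fun v _ => Finset.card_filter_le _ _)

end Success

end Network

theorem corollary4 {V E F : Type*} [Fintype V] [Fintype E] [Field F] [Fintype F]
    (N : Network V E) (s : V) (T : Finset V) (hs : s ∉ T) (w : ℕ)
    (hw : ∀ t ∈ T, w ≤ N.minCut s t)
    (b u : ℕ) (hu : u < T.card)
    (hsum : ∑ t ∈ T, N.minInternal s w t = T.card * b + u)
    (a : ℝ) (ha : a = codingConst F w) :
    (T.card * a ≤ 1 →
      N.failureProb F s w T ≤ 1 - (1 - a) ^ T.card * (1 - T.card * a) ^ b * (1 - u * a)) ∧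
    N.failureProb F s w T ≤
      1 - (1 - a) ^ T.card * (max 0 (1 - T.card * a)) ^ b * max 0 (1 - u * a) := by
  have ha' : 1 - invProb F w = a := ha.symm
  have ha0 : 0 ≤ a := by
    rw [← ha']
    exact sub_nonneg.2 ((invProb_antitone F (Nat.zero_le w)).trans (invProb_zero F).le)
  have hmain : N.failureProb F s w T ≤
      1 - (1 - a) ^ T.card * (max 0 (1 - T.card * a)) ^ b * max 0 (1 - u * a) := by
    -- For `w = 0` there is no path and so no last tail node, but then `a = 0` and a rank below `0`
    -- is impossible.
    rcases Nat.eq_zero_or_pos w with rfl | hwpos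
    · rw [invProb_zero, sub_self] at ha'
      subst ha'
      simp [Network.failureProb]
    · have hT : 0 < T.card := by omega
      have h := N.failureProb_le_worstProduct (F := F) hs (Finset.card_pos.1 hT) hwpos hw
      obtain ⟨h1, h2⟩ : (T.card * b + u) / T.card = b ∧ (T.card * b + u) % T.card = u :=
        (Nat.div_mod_unique hT).2 ⟨add_comm _ _, hu⟩
      rw [hsum, worstProduct, h1, h2, ha', show invProb F w = 1 - a by linarith] at h
      rw [mul_assoc]
      exact h
  refine ⟨fun hla => ?_, hmain⟩
  have hua : (u : ℝ) * a ≤ T.card * a :=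
    mul_le_mul_of_nonneg_right (by exact_mod_cast hu.le) ha0
  rwa [max_eq_right (by linarith), max_eq_right (by linarith)] at hmain
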